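/- Equip $\mathbb{Z}^2$ with the Euclidean distance $d_2$, write $B(x,s)=\{z\in\mathbb{Z}^2 : d_2(x,z)\le s\}$, and let $\mathcal{D}=\{d_2(x,y) : x,y\in\mathbb{Z}^2\}$ be the set of achievable distances. A set $C\subseteq\mathbb{Z}^2$ is a perfect code if for some real $s>0$ every $z\in\mathbb{Z}^2$ lies in $B(x,s)$ for exactly one $x\in C$. The packing radius of $C$ is the largest $r\in\mathcal{D}$ such that the balls $B(x,r)$, $x\in C$, are pairwise disjoint. A linear $r$-perfect code is an additive subgroup $\Lambda\subseteq\mathbb{Z}^2$ that is a perfect code with packing radius $r$; equivalently, $r \in \mathcal{D}$ and the balls $B(x,r)$, $x\in\Lambda$, tile $\mathbb{Z}^2$. **Theorem.** If $r>0$ and there is a linear $r$-perfect code in $\mathbb{Z}^2$ in the $\ell_2$ metric, then $r\in\{1,\sqrt2,2,2\sqrt2\}$. Conversely, each of these radii occurs: the subgroups of $\mathbb{Z}^2$ generated by $\{(1,2),(0,5)\}$, $\{(3,2),(0,3)\}$, $\{(1,5),(3,2)\}$ and $\{(5,4),(0,5)\}$ are linear $r$-perfect codes for $r=1$, $\sqrt2$,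 $2$ and $2\sqrt2$, respectively. -/

import Mathlib

/-- The `ℓ₂` distance between two points of `ℤⁿ`. -/
noncomputable def l2Dist {n : ℕ} (x y : Fin n → ℤ) : ℝ :=
  Real.sqrt (∑ i, ((x i : ℝ) - (y i : ℝ)) ^ 2)

/-- The closed `ℓ₂` ball in `ℤⁿ` with centre `x` and radius `r`. -/
def l2Ball {n : ℕ} (x : Fin n → ℤ) (r : ℝ) : Set (Fin n → ℤ) :=
  {z | l2Dist x z ≤ r}

/-- The set of all `ℓ₂` distances achieved between points of `ℤⁿ`. -/
def l2DistanceSet (n : ℕ) : Set ℝ :=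
  {d | ∃ x y : Fin n → ℤ, l2Dist x y = d}

/-- `C ⊆ ℤⁿ` is a perfect code in the `ℓ₂` metric: for some radius `s > 0`, every point of `ℤⁿ`
lies in the ball of radius `s` around exactly one codeword. -/
def IsPerfectCode {n : ℕ} (C : Set (Fin n → ℤ)) : Prop :=
  ∃ s : ℝ, 0 < s ∧ ∀ z : Fin n → ℤ, ∃! x, x ∈ C ∧ l2Dist x z ≤ s

/-- `r` is the packing radius of `C ⊆ ℤⁿ`: the largest achievable distance for which the balls of
that radius around distinct codewords are disjoint. -/
def IsPackingRadius {n : ℕ} (C : Set (Fin n → ℤ)) (r : ℝ) : Prop :=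
  IsGreatest {s | s ∈ l2DistanceSet n ∧ C.PairwiseDisjoint (fun x => l2Ball x s)} r

/-- An `r`-perfect code: a perfect code whose packing radius is `r`. -/
def IsRPerfectCode {n : ℕ} (C : Set (Fin n → ℤ)) (r : ℝ) : Prop :=
  IsPerfectCode C ∧ IsPackingRadius C r

/-!
A linear perfect code of radius `r = √R` is a subgroup `Λ` such that the balls of radius `r` around
its points tile `ℤ²`. If `v ∈ Λ` is nonzero, the balls around `0` and `v` must not share an integer
point next to `v / 2`, which forces `2 r < ‖v‖ + 1`. On the other hand, for a shortest nonzero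
`v ∈ Λ` some point of the plane has distance at least `‖v‖ / √3` from `Λ`, whereas the tiling brings
`Λ` within `r + √2 / 2` of every point of the plane. The two inequalities leave only `R < 69`.

For each of these `R`, the index of `Λ` is the number `N` of integer points of the ball, so `Λ` is
spanned by `(a, b)` and `(0, d)` with `a d = N` and `0 ≤ b < d`. Unless `R ∈ {1, 2, 4, 8}`, each of
these finitely many lattices contains a short vector violating the midpoint condition.

Conversely, each of the four codes is the kernel of a linear form modulo `N` that takes every value
exactly once on the ball.
-/

open Finset

section General

variable {n : ℕ} {r : ℝ}

theorem l2Dist_eq_sqrt_dotProduct (x y : Fin n → ℤ) :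
    l2Dist x y = √((x - y) ⬝ᵥ (x - y) : ℤ) := by
  simp only [l2Dist, dotProduct, Pi.sub_apply, ← sq]
  push_cast
  rfl

theorem l2Dist_comm (x y : Fin n → ℤ) : l2Dist x y = l2Dist y x := by
  rw [l2Dist_eq_sqrt_dotProduct, l2Dist_eq_sqrt_dotProduct, ← neg_sub y x, neg_dotProduct_neg]

theorem l2Dist_add_left (a x y : Fin n → ℤ) : l2Dist (a + x) (a + y) = l2Dist x y := by
  rw [l2Dist_eq_sqrt_dotProduct, l2Dist_eq_sqrt_dotProduct, add_sub_add_left_eq_sub]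

theorem l2Dist_le_sqrt_iff {x y : Fin n → ℤ} {R : ℕ} :
    l2Dist x y ≤ √R ↔ (x - y) ⬝ᵥ (x - y) ≤ R := by
  rw [l2Dist_eq_sqrt_dotProduct, Real.sqrt_le_sqrt_iff R.cast_nonneg]
  exact_mod_cast Iff.rfl

theorem mem_l2Ball_zero_sqrt_iff {x : Fin n → ℤ} {R : ℕ} :
    x ∈ l2Ball 0 √R ↔ x ⬝ᵥ x ≤ R := by
  rw [l2Ball, Set.mem_ofPred_eq, l2Dist_comm, l2Dist_le_sqrt_iff, sub_zero]

theorem mem_l2DistanceSet_iff_exists_nat :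
    r ∈ l2DistanceSet n ↔ ∃ R : ℕ, (∃ u : Fin n → ℤ, u ⬝ᵥ u = R) ∧ r = √R := by
  constructor
  · rintro ⟨x, y, rfl⟩
    obtain ⟨R, hR⟩ : ∃ R : ℕ, (x - y) ⬝ᵥ (x - y) = R :=
      Int.eq_ofNat_of_zero_le (sum_nonneg fun i _ => mul_self_nonneg ((x - y) i))
    exact ⟨R, ⟨_, hR⟩, by rw [l2Dist_eq_sqrt_dotProduct, hR, Int.cast_natCast]⟩
  · rintro ⟨R, ⟨u, hu⟩, rfl⟩
    exact ⟨u, 0, by rw [l2Dist_eq_sqrt_dotProduct, sub_zero, hu, Int.cast_natCast]⟩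

/-- The balls of radius `r` around the points of `C` tile `ℤⁿ`. Unlike `IsRPerfectCode`, this does
not require `r` to be an achievable distance. -/
def IsBallTiling (C : Set (Fin n → ℤ)) (r : ℝ) : Prop :=
  ∀ z, ∃! x, x ∈ C ∧ l2Dist x z ≤ r

theorem IsBallTiling.pairwiseDisjoint {C : Set (Fin n → ℤ)} (h : IsBallTiling C r) :
    C.PairwiseDisjoint (fun x => l2Ball x r) := by
  intro x hx y hy hne
  rw [Function.onFun, Set.disjoint_left]
  exact fun z hxz hyz => hne ((h z).unique ⟨hx, hxz⟩ ⟨hy, hyz⟩)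

theorem isRPerfectCode_iff_isBallTiling {C : Set (Fin n → ℤ)} (hr : 0 < r) :
    IsRPerfectCode C r ↔ r ∈ l2DistanceSet n ∧ IsBallTiling C r := by
  constructor
  · rintro ⟨⟨s, -, hs : IsBallTiling C s⟩, ⟨hrD, hdisj⟩, hmax⟩
    refine ⟨hrD, fun z => ?_⟩
    obtain ⟨x, hx, hxz⟩ := (hs z).exists
    have hle : l2Dist x z ≤ r := hmax ⟨⟨x, z, rfl⟩, hs.pairwiseDisjoint.mono
      fun _ _ (hw : _ ≤ _) => hw.trans hxz⟩
    exact ⟨x, ⟨hx, hle⟩, fun y hy => hdisj.elim_set hy.1 hx z hy.2 hle⟩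
  · rintro ⟨hrD, h⟩
    refine ⟨⟨r, hr, h⟩, ⟨hrD, h.pairwiseDisjoint⟩, ?_⟩
    rintro _ ⟨⟨u, v, rfl⟩, hdisj⟩
    by_contra! hlt
    obtain ⟨x, hx, -⟩ := (h 0).exists
    -- `z` is at distance `l2Dist u v` from `x`, hence is covered by another codeword.
    set z := x - u + v
    have hxz : l2Dist x z = l2Dist u v := by
      rw [← l2Dist_add_left (x - u) u v, sub_add_cancel]
    obtain ⟨y, hy, hyz⟩ := (h z).exists
    obtain rfl := hdisj.elim_set hx hy z hxz.le (hyz.trans hlt.le)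
    exact hlt.not_ge (hxz ▸ hyz)

theorem sub_mem_l2Ball_zero_iff {x z : Fin n → ℤ} : z - x ∈ l2Ball 0 r ↔ l2Dist x z ≤ r := by
  rw [l2Ball, Set.mem_ofPred_eq, ← l2Dist_add_left x, add_zero, add_sub_cancel]

theorem isBallTiling_iff_isComplement {Λ : AddSubgroup (Fin n → ℤ)} :
    IsBallTiling (Λ : Set (Fin n → ℤ)) r ↔
      AddSubgroup.IsComplement (Λ : Set (Fin n → ℤ)) (l2Ball 0 r) := by
  rw [AddSubgroup.isComplement_iff_existsUnique_neg_add_mem]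
  refine forall_congr' fun z => ?_
  simp only [neg_add_eq_sub, sub_mem_l2Ball_zero_iff, ExistsUnique, Subtype.exists, Subtype.forall,
    Subtype.mk.injEq, SetLike.mem_coe, and_imp, exists_prop, and_assoc]

theorem IsBallTiling.lt_l2Dist {Λ : AddSubgroup (Fin n → ℤ)}
    (h : IsBallTiling (Λ : Set (Fin n → ℤ)) r) {v p : Fin n → ℤ} (hv : v ∈ Λ) (hv0 : v ≠ 0)
    (hp : l2Dist 0 p ≤ r) : r < l2Dist v p := by
  by_contra! hvp
  exact hv0 ((h p).unique ⟨hv, hvp⟩ ⟨Λ.zero_mem, hp⟩)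

theorem isBallTiling_ker {A : Type*} [AddGroup A] {φ : (Fin n → ℤ) →+ A}
    (h : Set.BijOn φ (l2Ball 0 r) Set.univ) : IsBallTiling (φ.ker : Set (Fin n → ℤ)) r := by
  intro z
  obtain ⟨b, hb, hbz⟩ := h.surjOn (Set.mem_univ (φ z))
  refine ⟨z - b, ⟨?_, ?_⟩, ?_⟩
  · rw [SetLike.mem_coe, AddMonoidHom.mem_ker, map_sub, hbz, sub_self]
  · rwa [← sub_mem_l2Ball_zero_iff, sub_sub_cancel]
  · rintro x ⟨hx : φ x = 0, hxz⟩
    have hzx : z - x = b :=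
      h.injOn (sub_mem_l2Ball_zero_iff.2 hxz) hb (by rw [map_sub, hx, sub_zero, hbz])
    rw [← hzx, sub_sub_cancel]

/-- The integer points of the closed ball of radius `√R` around the origin of `ℤⁿ`, as a finset. -/
noncomputable def intBall (n R : ℕ) : Finset (Fin n → ℤ) :=
  {x ∈ Fintype.piFinset fun _ => Icc (-(R.sqrt : ℤ)) R.sqrt | x ⬝ᵥ x ≤ R}

theorem coe_intBall (n R : ℕ) : (intBall n R : Set (Fin n → ℤ)) = l2Ball 0 √R := by
  ext x
  simp only [intBall, mem_l2Ball_zero_sqrt_iff, coe_filter, Set.mem_ofPred_eq,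
    and_iff_right_iff_imp, Fintype.mem_piFinset, mem_Icc, ← abs_le]
  intro hx i
  have hi : x i * x i ≤ R :=
    (single_le_sum (fun j _ => mul_self_nonneg (x j)) (mem_univ i)).trans hx
  rwa [Int.abs_eq_natAbs, Nat.cast_le, Nat.le_sqrt, ← Int.ofNat_le, Int.natAbs_mul_self]

theorem IsBallTiling.index_eq {R : ℕ} {Λ : AddSubgroup (Fin n → ℤ)}
    (h : IsBallTiling (Λ : Set (Fin n → ℤ)) √R) : Λ.index = #(intBall n R) := by
  rw [← Set.ncard_coe_finset, coe_intBall, (isBallTiling_iff_isComplement.1 h).ncard_right]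

theorem exists_shortest_vector {Λ : AddSubgroup (Fin n → ℤ)} (hΛ : Λ ≠ ⊥) :
    ∃ v ∈ Λ, v ≠ 0 ∧ ∀ w ∈ Λ, w ≠ 0 → l2Dist v 0 ≤ l2Dist w 0 := by
  obtain ⟨v, ⟨hv, hv0⟩, hmin⟩ := exists_minimalFor_of_wellFoundedLT (fun v => v ∈ Λ ∧ v ≠ 0)
    (fun v => (v ⬝ᵥ v).toNat) (Λ.bot_or_exists_ne_zero.resolve_left hΛ)
  refine ⟨v, hv, hv0, fun w hw hw0 => ?_⟩
  have hle : (v ⬝ᵥ v).toNat ≤ (w ⬝ᵥ w).toNat :=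
    (le_total _ _).elim id (hmin ⟨hw, hw0⟩)
  have hw : 0 ≤ w ⬝ᵥ w := sum_nonneg fun i _ => mul_self_nonneg (w i)
  rw [l2Dist_eq_sqrt_dotProduct, l2Dist_eq_sqrt_dotProduct, sub_zero, sub_zero]
  gcongr
  lia

end General

section HermiteNormalForm

theorem exists_hermite_relations {A : Type*} [AddCommGroup A] [Finite A] {x y : A}
    (hxy : AddSubgroup.closure {x, y} = ⊤) :
    ∃ a d b : ℕ, a * d = Nat.card A ∧ b < d ∧ d • y = 0 ∧ a • x + b • y = 0 := by
  classical
  set Y := AddSubgroup.zmultiples y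
  let x' : A ⧸ Y := QuotientAddGroup.mk x
  have hgen : ∀ q : A ⧸ Y, q ∈ AddSubgroup.zmultiples x' := by
    rintro ⟨g⟩
    obtain ⟨m, k, rfl⟩ := AddSubgroup.mem_closure_pair.1 (hxy ▸ AddSubgroup.mem_top g)
    have hk : k • y ∈ Y := Y.zsmul_mem (AddSubgroup.mem_zmultiples y) k
    exact ⟨m, (QuotientAddGroup.mk_add_of_mem (m • x) hk).symm⟩
  have hmem : -(addOrderOf x' • x) ∈ Y := by
    rw [Y.neg_mem_iff, ← QuotientAddGroup.eq_zero_iff, QuotientAddGroup.mk_nsmul]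
    exact addOrderOf_nsmul_eq_zero x'
  obtain ⟨b, hb, hby⟩ := mem_image.1 (mem_zmultiples_iff_mem_range_addOrderOf.1 hmem)
  refine ⟨addOrderOf x', addOrderOf y, b, ?_, mem_range.1 hb, addOrderOf_nsmul_eq_zero y, ?_⟩
  · rw [Y.card_eq_card_quotient_mul_card_addSubgroup, Nat.card_zmultiples,
      addOrderOf_eq_card_of_forall_mem_zmultiples hgen]
  · rw [show b • y = _ from hby, add_neg_cancel]

theorem closure_unit_vectors_eq_top : AddSubgroup.closure {![(1 : ℤ), 0], ![0, 1]} = ⊤ := by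
  refine eq_top_iff.2 fun z _ => AddSubgroup.mem_closure_pair.2 ⟨z 0, z 1, ?_⟩
  ext i
  fin_cases i <;> simp

theorem exists_hermite_basis_mem {Λ : AddSubgroup (Fin 2 → ℤ)} (hΛ : Λ.index ≠ 0) :
    ∃ a d b : ℕ, a * d = Λ.index ∧ b < d ∧ ![(a : ℤ), b] ∈ Λ ∧ ![0, (d : ℤ)] ∈ Λ := by
  have : Λ.FiniteIndex := ⟨hΛ⟩
  have hgen : AddSubgroup.closure
      {QuotientAddGroup.mk' Λ ![1, 0], QuotientAddGroup.mk' Λ ![0, 1]} = ⊤ := by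
    rw [← Set.image_pair, ← AddMonoidHom.map_closure, closure_unit_vectors_eq_top,
      AddSubgroup.map_top_of_surjective _ (QuotientAddGroup.mk'_surjective Λ)]
  obtain ⟨a, d, b, hN, hb, hd, hab⟩ := exists_hermite_relations hgen
  rw [← map_nsmul, QuotientAddGroup.mk'_apply, QuotientAddGroup.eq_zero_iff] at hd
  rw [← map_nsmul, ← map_nsmul, ← map_add, QuotientAddGroup.mk'_apply,
    QuotientAddGroup.eq_zero_iff] at hab
  refine ⟨a, d, b, hN, hb, ?_, ?_⟩
  · simpa using hab
  · simpa using hd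

end HermiteNormalForm

section Hole

theorem eq_intCast_or_sqrt_three_le_two_mul_abs_im {L : AddSubgroup ℂ} (h1 : 1 ∈ L)
    (hL : ∀ l ∈ L, l ≠ 0 → 1 ≤ ‖l‖) {l : ℂ} (hl : l ∈ L) :
    (∃ m : ℤ, l = m) ∨ √3 ≤ 2 * |l.im| := by
  by_cases hm : l - round l.re = 0
  · exact .inl ⟨_, sub_eq_zero.1 hm⟩
  · right
    have hmem : l - round l.re ∈ L := L.sub_mem hl (by simpa using L.zsmul_mem h1 (round l.re))
    have hre : (l.re - round l.re) ^ 2 ≤ (1 / 2) ^ 2 := by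
      rw [← sq_abs]
      exact pow_le_pow_left₀ (abs_nonneg _) (abs_sub_round l.re) 2
    have hnorm : 1 ≤ ‖l - round l.re‖ ^ 2 := one_le_pow₀ (hL _ hmem hm)
    rw [Complex.sq_norm, Complex.normSq_apply] at hnorm
    rw [Real.sqrt_le_left (by positivity), mul_pow, sq_abs]
    simp only [Complex.sub_re, Complex.intCast_re, Complex.sub_im, Complex.intCast_im,
      sub_zero] at hnorm
    linarith

theorem exists_hole_of_one_mem {L : AddSubgroup ℂ} (h1 : 1 ∈ L)
    (hL : ∀ l ∈ L, l ≠ 0 → 1 ≤ ‖l‖) : ∃ z : ℂ, ∀ l ∈ L, 1 ≤ √3 * ‖z - l‖ := by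
  have h3 : √3 ^ 2 = 3 := Real.sq_sqrt zero_le_three
  -- The circumcentre of the equilateral triangle with vertices `0`, `1` and `(1 + √3 i) / 2`.
  refine ⟨⟨1 / 2, √3 / 6⟩, fun l hl => ?_⟩
  rw [← one_le_sq_iff₀ (by positivity), mul_pow, h3, Complex.sq_norm, Complex.normSq_apply]
  rcases eq_intCast_or_sqrt_three_le_two_mul_abs_im h1 hL hl with ⟨m, rfl⟩ | him
  · have hm : 1 ≤ (2 * m - 1 : ℝ) ^ 2 := by
      exact_mod_cast (one_le_sq_iff_one_le_abs (2 * m - 1)).2 (Int.one_le_abs (by lia))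
    simp only [Complex.sub_re, Complex.intCast_re, Complex.sub_im, Complex.intCast_im, sub_zero]
    nlinarith
  · have hdist : √3 / 3 ≤ |√3 / 6 - l.im| := by
      have htri := abs_sub_abs_le_abs_sub l.im (√3 / 6)
      rw [abs_sub_comm, abs_of_nonneg (a := √3 / 6) (by positivity)] at htri
      linarith
    have hdist_sq := pow_le_pow_left₀ (by positivity) hdist 2
    rw [sq_abs] at hdist_sq
    rw [Complex.sub_re, Complex.sub_im]
    nlinarith [sq_nonneg (1 / 2 - l.re)]

theorem exists_hole {L : AddSubgroup ℂ} {v : ℂ} (hv : v ∈ L) (hv0 : v ≠ 0)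
    (hmin : ∀ l ∈ L, l ≠ 0 → ‖v‖ ≤ ‖l‖) : ∃ z : ℂ, ∀ l ∈ L, ‖v‖ ≤ √3 * ‖z - l‖ := by
  obtain ⟨z, hz⟩ := exists_hole_of_one_mem (L := L.comap (AddMonoidHom.mulLeft v)) (by simpa)
    fun l hl hl0 => by simpa [hv0] using hmin (v * l) hl (mul_ne_zero hv0 hl0)
  refine ⟨v * z, fun l hl => ?_⟩
  have h := hz (v⁻¹ * l) (by simpa [hv0])
  calc ‖v‖ ≤ ‖v‖ * (√3 * ‖z - v⁻¹ * l‖) := le_mul_of_one_le_right (norm_nonneg v) h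
    _ = √3 * ‖v * z - l‖ := by
      rw [mul_left_comm, ← norm_mul, mul_sub, mul_inv_cancel_left₀ hv0]

end Hole

section Planar

variable {R : ℕ} {Λ : AddSubgroup (Fin 2 → ℤ)}

theorem l2Dist_le_sqrt_iff_natAbs {x y : Fin 2 → ℤ} :
    l2Dist x y ≤ √R ↔ (x 0 - y 0).natAbs * (x 0 - y 0).natAbs +
      (x 1 - y 1).natAbs * (x 1 - y 1).natAbs ≤ R := by
  rw [l2Dist_le_sqrt_iff, dotProduct, Fin.sum_univ_two, ← Int.ofNat_le, Int.natCast_add,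
    Int.natAbs_mul_self, Int.natAbs_mul_self]
  rfl

/-- The point `(i, j)` is within `√R` of both the origin and `(x, y)`. -/
def IsCommonPoint (R x y i j : ℕ) : Prop :=
  i * i + j * j ≤ R ∧ (x - i) * (x - i) + (y - j) * (y - j) ≤ R

theorem IsBallTiling.not_isCommonPoint (h : IsBallTiling (Λ : Set (Fin 2 → ℤ)) √R)
    {v : Fin 2 → ℤ} (hv : v ∈ Λ) (hv0 : v ≠ 0) {i j : ℕ} (hi : i ≤ (v 0).natAbs)
    (hj : j ≤ (v 1).natAbs) : ¬ IsCommonPoint R (v 0).natAbs (v 1).natAbs i j := by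
  rintro ⟨hij, hvij⟩
  have hsign {a : ℤ} {k : ℕ} (hk : k ≤ a.natAbs) :
      ∃ c : ℤ, c.natAbs = k ∧ (a - c).natAbs = a.natAbs - k := by
    rcases le_total 0 a with ha | ha
    · exact ⟨k, by lia, by lia⟩
    · exact ⟨-k, by lia, by lia⟩
  obtain ⟨c, hc, hvc⟩ := hsign hi
  obtain ⟨e, he, hve⟩ := hsign hj
  refine (h.lt_l2Dist (p := ![c, e]) hv hv0 ?_).not_ge ?_
  · simpa [l2Dist_le_sqrt_iff_natAbs, hc, he] using hij
  · simpa [l2Dist_le_sqrt_iff_natAbs, hvc, hve] using hvij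

theorem IsBallTiling.four_mul_sq_radius_lt (h : IsBallTiling (Λ : Set (Fin 2 → ℤ)) √R)
    {v : Fin 2 → ℤ} (hv : v ∈ Λ) (hv0 : v ≠ 0) :
    (4 * R : ℝ) < (l2Dist v 0 + 1) ^ 2 := by
  set x := (v 0).natAbs
  set y := (v 1).natAbs
  have hxy : 4 * R < (x + 1) * (x + 1) + y * y ∨ 4 * R < x * x + (y + 1) * (y + 1) := by
    by_contra! hle
    have half_sq (m : ℕ) : 4 * (m / 2 * (m / 2)) ≤ m * m := by
      nlinarith [Nat.mul_self_le_mul_self (Nat.div_mul_le_self m 2)]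
    refine h.not_isCommonPoint hv hv0 (i := (x + 1) / 2) (j := y / 2) (by lia) (by lia) ⟨?_, ?_⟩
    · linarith [half_sq (x + 1), half_sq y]
    · rw [show x - (x + 1) / 2 = x / 2 by lia, show y - y / 2 = (y + 1) / 2 by lia]
      linarith [half_sq x, half_sq (y + 1)]
  have hnorm : l2Dist v 0 ^ 2 = x ^ 2 + y ^ 2 := by
    rw [l2Dist, Real.sq_sqrt (sum_nonneg fun i _ => sq_nonneg _), Fin.sum_univ_two]
    simp [x, y]
  have hx : (x : ℝ) ≤ l2Dist v 0 := le_of_sq_le_sq (by nlinarith) (Real.sqrt_nonneg _)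
  have hy : (y : ℝ) ≤ l2Dist v 0 := le_of_sq_le_sq (by nlinarith) (Real.sqrt_nonneg _)
  have hxy' : (4 * R : ℝ) < (x + 1) * (x + 1) + y * y ∨ (4 * R : ℝ) < x * x + (y + 1) * (y + 1) :=
    mod_cast hxy
  rcases hxy' with h | h <;> linarith

/-- The integer lattice of the complex plane, `ℤ² ≃ ℤ[i] ⊆ ℂ`, which makes `l2Dist` available as a
norm at non-integral points. -/
def toComplex : (Fin 2 → ℤ) →+ ℂ where
  toFun z := ⟨z 0, z 1⟩
  map_zero' := by simp [Complex.ext_iff]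
  map_add' x y := by simp [Complex.ext_iff]

theorem toComplex_injective : Function.Injective toComplex := by
  intro x y hxy
  ext i
  fin_cases i
  · simpa [toComplex] using congrArg Complex.re hxy
  · simpa [toComplex] using congrArg Complex.im hxy

theorem norm_toComplex_sub (x y : Fin 2 → ℤ) : ‖toComplex x - toComplex y‖ = l2Dist x y := by
  rw [Complex.norm_def, Complex.normSq_apply, l2Dist, Fin.sum_univ_two, sq, sq]
  rfl

theorem norm_toComplex (x : Fin 2 → ℤ) : ‖toComplex x‖ = l2Dist x 0 := by
  rw [← norm_toComplex_sub, map_zero, sub_zero]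

theorem exists_norm_sub_toComplex_le_sqrt_two_div_two (z : ℂ) :
    ∃ p, ‖z - toComplex p‖ ≤ √2 / 2 := by
  refine ⟨![round z.re, round z.im], ?_⟩
  have hre : |z.re - round z.re| ≤ 1 / 2 := abs_sub_round z.re
  have him : |z.im - round z.im| ≤ 1 / 2 := abs_sub_round z.im
  rw [← abs_of_pos (a := (1 / 2 : ℝ)) (by norm_num), ← sq_le_sq] at hre him
  rw [Complex.norm_def, Complex.normSq_apply]
  refine Real.sqrt_le_iff.2 ⟨by positivity, ?_⟩
  rw [div_pow, Real.sq_sqrt zero_le_two]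
  simp only [toComplex, AddMonoidHom.coe_mk, ZeroHom.coe_mk, Matrix.cons_val_zero,
    Matrix.cons_val_one, Complex.sub_re, Complex.sub_im]
  linarith

theorem IsBallTiling.exists_norm_sub_toComplex_le {r : ℝ}
    (h : IsBallTiling (Λ : Set (Fin 2 → ℤ)) r) (z : ℂ) :
    ∃ v ∈ Λ, ‖z - toComplex v‖ ≤ r + √2 / 2 := by
  obtain ⟨p, hp⟩ := exists_norm_sub_toComplex_le_sqrt_two_div_two z
  obtain ⟨v, hv, hvp⟩ := (h p).exists
  rw [← norm_toComplex_sub, norm_sub_rev] at hvp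
  exact ⟨v, hv, by linarith [norm_sub_le_norm_sub_add_norm_sub z (toComplex p) (toComplex v)]⟩

theorem exists_ne_zero_l2Dist_le_of_covering (hΛ : Λ ≠ ⊥) {ρ : ℝ}
    (hcover : ∀ z : ℂ, ∃ v ∈ Λ, ‖z - toComplex v‖ ≤ ρ) :
    ∃ v ∈ Λ, v ≠ 0 ∧ l2Dist v 0 ≤ √3 * ρ := by
  obtain ⟨v, hv, hv0, hmin⟩ := exists_shortest_vector hΛ
  simp only [← norm_toComplex] at hmin
  obtain ⟨z, hz⟩ := exists_hole (L := Λ.map toComplex) (AddSubgroup.mem_map_of_mem _ hv)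
    ((map_ne_zero_iff _ toComplex_injective).2 hv0) (by
      rintro _ ⟨w, hw, rfl⟩ hw0
      exact hmin w hw (by rintro rfl; exact hw0 (map_zero _)))
  obtain ⟨w, hw, hwz⟩ := hcover z
  refine ⟨v, hv, hv0, (norm_toComplex v ▸ hz _ (AddSubgroup.mem_map_of_mem _ hw)).trans ?_⟩
  gcongr

theorem IsBallTiling.sq_radius_lt (h : IsBallTiling (Λ : Set (Fin 2 → ℤ)) √R) : R < 69 := by
  by_contra! hR
  have hΛ : Λ ≠ ⊥ := by
    rintro rfl
    have h0 : 0 ∈ intBall 2 R := by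
      rw [← mem_coe, coe_intBall, mem_l2Ball_zero_sqrt_iff, zero_dotProduct]
      exact R.cast_nonneg
    have hindex := h.index_eq
    rw [AddSubgroup.index_bot, Nat.card_eq_zero_of_infinite] at hindex
    exact card_ne_zero_of_mem h0 hindex.symm
  obtain ⟨v, hv, hv0, hle⟩ := exists_ne_zero_l2Dist_le_of_covering hΛ
    h.exists_norm_sub_toComplex_le
  have hlt : 2 * √R < l2Dist v 0 + 1 := by
    refine lt_of_pow_lt_pow_left₀ 2 (by rw [l2Dist]; positivity) ?_
    rw [mul_pow, Real.sq_sqrt R.cast_nonneg]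
    linarith [h.four_mul_sq_radius_lt hv hv0]
  -- The two bounds on `l2Dist v 0` give `√R < (2 + √3) * (1 + √6 / 2) < 8.3031`.
  have h2 : √2 < 1.41422 := by rw [Real.sqrt_lt'] <;> norm_num
  have h3 : √3 < 1.7321 := by rw [Real.sqrt_lt'] <;> norm_num
  have h69 : 8.3066 ≤ √R := Real.le_sqrt_of_sq_le (by
    have : (69 : ℝ) ≤ R := mod_cast hR
    linarith)
  have hub : √3 * (√R + √2 / 2) ≤ 1.7321 * (√R + 1.41422 / 2) := by gcongr
  linarith

end Planar

section FiniteSearch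

variable {R : ℕ} {Λ : AddSubgroup (Fin 2 → ℤ)}

instance (R x y i j : ℕ) : Decidable (IsCommonPoint R x y i j) :=
  inferInstanceAs (Decidable (_ ∧ _))

/-- An integer point next to the midpoint of the origin and `(x, y)` is within `√R` of both. Only
two of the neighbours of the midpoint are tested, which suffices for the search below. -/
def HasCommonMidpoint (R x y : ℕ) : Prop :=
  IsCommonPoint R x y ((x + 1) / 2) (y / 2) ∨ IsCommonPoint R x y ((x + 1) / 2) (y / 2 - 1)

instance (R x y : ℕ) : Decidable (HasCommonMidpoint R x y) :=
  inferInstanceAs (Decidable (_ ∨ _))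

/-- The balls of radius `√R` around the origin and some nonzero vector `(a * k, y)` of the lattice
spanned by `(a, b)` and `(0, d)` overlap near the midpoint of their centres. Only `k < 20` and, for
each `k`, the two values of `y` closest to `0` are tested. -/
def HermiteOverlap (R a d b : ℕ) : Prop :=
  ∃ k ∈ List.range 20,
    (0 < a * k + k * b % d ∧ HasCommonMidpoint R (a * k) (k * b % d)) ∨
      HasCommonMidpoint R (a * k) (d - k * b % d)

instance (R a d b : ℕ) : Decidable (HermiteOverlap R a d b) :=
  inferInstanceAs (Decidable (∃ k ∈ List.range 20, _ ∨ _))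

theorem IsBallTiling.not_hasCommonMidpoint (h : IsBallTiling (Λ : Set (Fin 2 → ℤ)) √R)
    {v : Fin 2 → ℤ} (hv : v ∈ Λ) (hv0 : v ≠ 0) :
    ¬ HasCommonMidpoint R (v 0).natAbs (v 1).natAbs := by
  rintro (hp | hp) <;> exact h.not_isCommonPoint hv hv0 (by lia) (by lia) hp

theorem IsBallTiling.not_hermiteOverlap (h : IsBallTiling (Λ : Set (Fin 2 → ℤ)) √R) {a d b : ℕ}
    (hbd : b < d) (hab : ![(a : ℤ), b] ∈ Λ) (hd : ![0, (d : ℤ)] ∈ Λ) :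
    ¬ HermiteOverlap R a d b := by
  rintro ⟨k, -, hk⟩
  set y := k * b % d
  have hyd : y < d := Nat.mod_lt _ (by lia)
  have hy : ![(a * k : ℤ), y] ∈ Λ := by
    convert Λ.sub_mem (Λ.nsmul_mem hab k) (Λ.nsmul_mem hd (k * b / d)) using 1
    have hmod : (y : ℤ) = k * b - (k * b / d : ℕ) * d := by
      rw [eq_sub_iff_add_eq, mul_comm _ (d : ℤ)]
      exact_mod_cast Nat.mod_add_div (k * b) d
    ext i
    fin_cases i <;> simp [hmod, mul_comm]
  have hyd' : ![(a * k : ℤ), y - d] ∈ Λ := by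
    simpa [sub_eq_add_neg] using Λ.sub_mem hy hd
  rcases hk with ⟨hpos, hk⟩ | hk
  · refine h.not_hasCommonMidpoint hy (fun h0 => ?_) (by simpa [Int.natAbs_mul] using hk)
    have hx : (a * k : ℤ) = 0 := congrFun h0 0
    have hy : (y : ℤ) = 0 := congrFun h0 1
    norm_cast at hx hy
    lia
  · refine h.not_hasCommonMidpoint hyd' (fun h0 => ?_) ?_
    · have : (y - d : ℤ) = 0 := congrFun h0 1
      lia
    · have : (y - d : ℤ).natAbs = d - y := by lia
      simpa [Int.natAbs_mul, this] using hk

/-- The sums of two squares `4 < R < 69` with `R ≠ 8`, each with the number of integer points of the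
disc of radius `√R`. -/
def gaussCircleCounts : List (ℕ × ℕ) :=
  [(5, 21), (9, 29), (10, 37), (13, 45), (16, 49), (17, 57), (18, 61), (20, 69), (25, 81), (26, 89),
    (29, 97), (32, 101), (34, 109), (36, 113), (37, 121), (40, 129), (41, 137), (45, 145),
    (49, 149), (50, 161), (52, 169), (53, 177), (58, 185), (61, 193), (64, 197), (65, 213),
    (68, 221)]

theorem mem_gaussCircleCounts : ∀ R < 69, (∃ i < 9, ∃ j < 9, i * i + j * j = R) →
    R ∈ [0, 1, 2, 4, 8] ∨ (R, #(intBall 2 R)) ∈ gaussCircleCounts := by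
  decide +kernel

theorem hermiteOverlap_of_mem_gaussCircleCounts : ∀ p ∈ gaussCircleCounts,
    ∀ a ∈ Icc 1 p.2, p.2 % a = 0 → ∀ b < p.2 / a, HermiteOverlap p.1 a (p.2 / a) b := by
  decide +kernel

theorem IsBallTiling.sq_radius_eq (h : IsBallTiling (Λ : Set (Fin 2 → ℤ)) √R) (hR : 0 < R)
    {u : Fin 2 → ℤ} (hu : u ⬝ᵥ u = R) : R = 1 ∨ R = 2 ∨ R = 4 ∨ R = 8 := by
  have hR69 := h.sq_radius_lt
  set i := (u 0).natAbs
  set j := (u 1).natAbs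
  have hij : i * i + j * j = R := by
    rw [dotProduct, Fin.sum_univ_two] at hu
    exact_mod_cast (by simpa [i, j] using hu : (i * i + j * j : ℤ) = R)
  rcases mem_gaussCircleCounts R hR69 ⟨i, by nlinarith, j, by nlinarith, hij⟩ with hmem | hmem
  · simp only [List.mem_cons, List.not_mem_nil] at hmem
    lia
  · have hcard : 0 < #(intBall 2 R) :=
      card_pos.2 ⟨u, by simp [← mem_coe, coe_intBall, mem_l2Ball_zero_sqrt_iff, hu]⟩
    obtain ⟨a, d, b, had, hbd, hab, hd⟩ := exists_hermite_basis_mem (h.index_eq ▸ hcard.ne')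
    rw [h.index_eq] at had
    have ha : 0 < a := Nat.pos_of_mul_pos_right (had ▸ hcard)
    have hdiv : #(intBall 2 R) / a = d := by rw [← had, Nat.mul_div_cancel_left d ha]
    have hov := hermiteOverlap_of_mem_gaussCircleCounts _ hmem a
      (mem_Icc.2 ⟨ha, Nat.le_of_dvd hcard ⟨d, had.symm⟩⟩) (had ▸ Nat.mul_mod_right a d) b
      (hdiv.symm ▸ hbd)
    exact absurd (hdiv ▸ hov) (h.not_hermiteOverlap hbd hab hd)

end FiniteSearch

section Codes

theorem sqrt_four : √(4 : ℕ) = 2 := by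
  rw [show ((4 : ℕ) : ℝ) = 2 ^ 2 by norm_num, Real.sqrt_sq zero_le_two]

theorem sqrt_eight : √(8 : ℕ) = 2 * √2 := by
  rw [show ((8 : ℕ) : ℝ) = 2 ^ 2 * 2 by norm_num, Real.sqrt_mul (by positivity),
    Real.sqrt_sq zero_le_two]

/-- The homomorphism `z ↦ α ⬝ᵥ z mod N`; the codes of the theorem are kernels of such maps, so that
the tiling property becomes a statement about the residues of the points of one ball. -/
def dotProductMod {n : ℕ} (N : ℕ) (α : Fin n → ℤ) : (Fin n → ℤ) →+ ZMod N where
  toFun z := ((α ⬝ᵥ z : ℤ) : ZMod N)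
  map_zero' := by simp
  map_add' x y := by simp [dotProduct_add]

theorem isRPerfectCode_ker {n R : ℕ} {A : Type*} [AddGroup A] [Fintype A] [DecidableEq A]
    {φ : (Fin n → ℤ) →+ A} (hR : 0 < R) {u : Fin n → ℤ} (hu : u ⬝ᵥ u = R)
    (hcard : #(intBall n R) = Fintype.card A) (himage : (intBall n R).image φ = univ) :
    IsRPerfectCode (φ.ker : Set (Fin n → ℤ)) √R := by
  refine (isRPerfectCode_iff_isBallTiling (Real.sqrt_pos.2 (mod_cast hR))).2
    ⟨mem_l2DistanceSet_iff_exists_nat.2 ⟨R, ⟨u, hu⟩, rfl⟩, isBallTiling_ker ?_⟩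
  rw [← coe_intBall]
  have hinj : Set.InjOn φ (intBall n R) := by
    rw [← card_image_iff, himage, hcard, card_univ]
  have hbij := hinj.bijOn_image
  rwa [← coe_image, himage, coe_univ] at hbij

theorem closure_pair_eq_ker {G H : Type*} [AddCommGroup G] [AddGroup H] {φ : G →+ H} {u w : G}
    (hu : φ u = 0) (hw : φ w = 0) (hker : ∀ z, φ z = 0 → ∃ m k : ℤ, m • u + k • w = z) :
    AddSubgroup.closure {u, w} = φ.ker := by
  refine le_antisymm ((AddSubgroup.closure_le _).2 ?_) fun z hz =>
    AddSubgroup.mem_closure_pair.2 (hker z hz)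
  rintro _ (rfl | rfl) <;> assumption

theorem isRPerfectCode_closure_pair {N R : ℕ} [NeZero N] {α₀ α₁ u₀ u₁ w₀ w₁ : ℤ}
    {p : Fin 2 → ℤ} (hR : 0 < R) (hp : p ⬝ᵥ p = R) (hcard : #(intBall 2 R) = Fintype.card (ZMod N))
    (himage : (intBall 2 R).image (dotProductMod N ![α₀, α₁]) = univ)
    (hu : dotProductMod N ![α₀, α₁] ![u₀, u₁] = 0) (hw : dotProductMod N ![α₀, α₁] ![w₀, w₁] = 0)
    (hker : ∀ x y k : ℤ, α₀ * x + α₁ * y = N * k →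
      ∃ m l : ℤ, m * u₀ + l * w₀ = x ∧ m * u₁ + l * w₁ = y) :
    IsRPerfectCode (AddSubgroup.closure {![u₀, u₁], ![w₀, w₁]} : Set (Fin 2 → ℤ)) √R := by
  rw [closure_pair_eq_ker hu hw fun z hz => ?_]
  · exact isRPerfectCode_ker hR hp hcard himage
  · obtain ⟨k, hk⟩ : (N : ℤ) ∣ ![α₀, α₁] ⬝ᵥ z := (ZMod.intCast_zmod_eq_zero_iff_dvd _ _).1 hz
    obtain ⟨m, l, hx, hy⟩ := hker (z 0) (z 1) k (by simpa [dotProduct] using hk)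
    refine ⟨m, l, ?_⟩
    ext i
    fin_cases i <;> simpa

theorem isRPerfectCode_one : IsRPerfectCode
    (AddSubgroup.closure ({![1, 2], ![0, 5]} : Set (Fin 2 → ℤ)) : Set (Fin 2 → ℤ)) 1 := by
  rw [← Real.sqrt_one, ← Nat.cast_one (R := ℝ)]
  exact isRPerfectCode_closure_pair (N := 5) (α₀ := -2) (α₁ := 1) (p := ![1, 0])
    (by decide) (by decide) (by decide +kernel) (by decide +kernel) (by decide) (by decide)
    fun x _ k _ => ⟨x, k, by lia, by lia⟩

theorem isRPerfectCode_sqrt_two : IsRPerfectCode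
    (AddSubgroup.closure ({![3, 2], ![0, 3]} : Set (Fin 2 → ℤ)) : Set (Fin 2 → ℤ)) √2 :=
  isRPerfectCode_closure_pair (R := 2) (N := 9) (α₀ := 1) (α₁ := 3) (p := ![1, 1])
    (by decide) (by decide) (by decide +kernel) (by decide +kernel) (by decide) (by decide)
    fun _ y k _ => ⟨3 * k - y, y - 2 * k, by lia, by lia⟩

theorem isRPerfectCode_two : IsRPerfectCode
    (AddSubgroup.closure ({![1, 5], ![3, 2]} : Set (Fin 2 → ℤ)) : Set (Fin 2 → ℤ)) 2 := by
  rw [← sqrt_four]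
  exact isRPerfectCode_closure_pair (N := 13) (α₀ := -5) (α₁ := 1) (p := ![2, 0])
    (by decide) (by decide) (by decide +kernel) (by decide +kernel) (by decide) (by decide)
    fun x _ k _ => ⟨x + 3 * k, -k, by lia, by lia⟩

theorem isRPerfectCode_two_mul_sqrt_two : IsRPerfectCode
    (AddSubgroup.closure ({![5, 4], ![0, 5]} : Set (Fin 2 → ℤ)) : Set (Fin 2 → ℤ)) (2 * √2) := by
  rw [← sqrt_eight]
  exact isRPerfectCode_closure_pair (N := 25) (α₀ := 1) (α₁ := 5) (p := ![2, 2])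
    (by decide) (by decide) (by decide +kernel) (by decide +kernel) (by decide) (by decide)
    fun _ y k _ => ⟨5 * k - y, y - 4 * k, by lia, by lia⟩

end Codes

theorem IsRPerfectCode.radius_eq {r : ℝ} (hr : 0 < r) {Λ : AddSubgroup (Fin 2 → ℤ)}
    (h : IsRPerfectCode (Λ : Set (Fin 2 → ℤ)) r) :
    r = 1 ∨ r = √2 ∨ r = 2 ∨ r = 2 * √2 := by
  obtain ⟨hrD, htile⟩ := (isRPerfectCode_iff_isBallTiling hr).1 h
  obtain ⟨R, ⟨u, hu⟩, rfl⟩ := mem_l2DistanceSet_iff_exists_nat.1 hrD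
  rcases htile.sq_radius_eq (by exact_mod_cast Real.sqrt_pos.1 hr) hu with rfl | rfl | rfl | rfl
  · simp
  · simp
  · exact .inr (.inr (.inl sqrt_four))
  · exact .inr (.inr (.inr sqrt_eight))

theorem theorem2 :
    (∀ r : ℝ, 0 < r → ∀ Λ : AddSubgroup (Fin 2 → ℤ),
      IsRPerfectCode (Λ : Set (Fin 2 → ℤ)) r →
        r = 1 ∨ r = Real.sqrt 2 ∨ r = 2 ∨ r = 2 * Real.sqrt 2) ∧
    IsRPerfectCode
      (AddSubgroup.closure ({![1, 2], ![0, 5]} : Set (Fin 2 → ℤ)) : Set (Fin 2 → ℤ)) 1 ∧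
    IsRPerfectCode
      (AddSubgroup.closure ({![3, 2], ![0, 3]} : Set (Fin 2 → ℤ)) : Set (Fin 2 → ℤ)) (Real.sqrt 2) ∧
    IsRPerfectCode
      (AddSubgroup.closure ({![1, 5], ![3, 2]} : Set (Fin 2 → ℤ)) : Set (Fin 2 → ℤ)) 2 ∧
    IsRPerfectCode
      (AddSubgroup.closure ({![5, 4], ![0, 5]} : Set (Fin 2 → ℤ)) : Set (Fin 2 → ℤ)) (2 * Real.sqrt 2) := by
  exact ⟨fun r hr Λ h => h.radius_eq hr, isRPerfectCode_one, isRPerfectCode_sqrt_two,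
    isRPerfectCode_two, isRPerfectCode_two_mul_sqrt_two⟩
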